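/- Let $d,n\ge 2$, $r\in\{1,\dots,n\}$, $\beta>0$, $\varepsilon\in(0,\tfrac1{16})$ and $\sigma>0$. For $w\in\mathbb S^{d-1}$ and $\eta>0$ let $\mathscr S(w,\eta)=\{x\in\mathbb S^{d-1}:\langle x,w\rangle\ge 1-\eta\}$. For points $w_1,\dots,w_k\in\mathbb S^{d-1}$ and $b>0$ put $$\alpha=\max\{\langle x,y\rangle: x\in\mathscr S(w_i,2\varepsilon),\ y\in\mathscr S(w_j,2\varepsilon),\ i\ne j\},\qquad \gamma(b)=1-\alpha-8\varepsilon-\frac1b\log\frac{2n^2}{\varepsilon}$$ (with $\alpha=-\infty$ and $\gamma(b)=+\infty$ if $k=1$). Call $(w_1,\dots,w_k)$ *$(\beta,\varepsilon)$-centered* if $\gamma(\beta)>0$ and $\gamma=\Omega(1)$, i.e. $\liminf_{b\to\infty}\gamma(b)>0$ (the $w_i$, $\varepsilon$ and $n$ being fixed). Call $(x_1,\dots,x_n)\in(\mathbb S^{d-1})^n$ *$(\beta,\varepsilon)$-separated* if there are $k\le n$ and a $(\beta,\varepsilon)$-centered $(v_1,\dots,v_k)\in(\mathbb S^{d-1})^k$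 such that $x_i\in\bigcup_{q=1}^k\mathscr S(v_q,\varepsilon)$ for all $i$. **Proposition 4.2.** Let $(w_1,\dots,w_r)\in(\mathbb S^{d-1})^r$ be $(\beta,\varepsilon)$-centered, and let $X_1,\dots,X_n$ be i.i.d. random vectors in $\mathbb R^d$ with the Gaussian mixture density $$f(x)=\frac1{r\,(2\pi\sigma^2)^{d/2}}\sum_{i=1}^r \exp\Big(-\frac{\|x-\sqrt r\,w_i\|^2}{2\sigma^2}\Big).$$ Put $\delta=\sigma/\sqrt r$ and assume $$\frac{6\delta\sqrt d}{1+\delta\sqrt d}+\delta\sqrt{2d\log n}\le\varepsilon .$$ Then $$\mathbb P\left(\left(\frac{X_1}{\|X_1\|},\dots,\frac{X_n}{\|X_n\|}\right)\text{ is }(\beta,\varepsilon)\text{-separated}\right)\ge 1-2e^{-d}.$$ -/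

import Mathlib

open MeasureTheory ProbabilityTheory Filter

noncomputable section

namespace SelfAttention

/-- The unit sphere `𝕊^{d-1}` of `ℝ^d`, as a type. -/
abbrev USphere (d : ℕ) : Type := Metric.sphere (0 : EuclideanSpace ℝ (Fin d)) 1

/-- The spherical cap `{x ∈ 𝕊^{d-1} : ⟨x, w⟩ ≥ 1 - ε}`. -/
def cap {d : ℕ} (w : USphere d) (ε : ℝ) : Set (EuclideanSpace ℝ (Fin d)) :=
  {x | x ∈ Metric.sphere (0 : EuclideanSpace ℝ (Fin d)) 1 ∧
    1 - ε ≤ inner ℝ x (w : EuclideanSpace ℝ (Fin d))}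

/-- `α`: the maximum of `⟨x, y⟩` over `x`, `y` in two differently labelled caps with parameter
`2ε`. It is a supremum in `[-∞, ∞]`, so that it is `-∞` when there is only one cap. For two or
more caps and `ε ≥ 0` the set is nonempty and compact, and this is the (real) maximum. -/
def alpha {d k : ℕ} (ε : ℝ) (w : Fin k → USphere d) : EReal :=
  sSup {a : EReal | ∃ i j : Fin k, i ≠ j ∧
    ∃ x ∈ cap (w i) (2 * ε), ∃ y ∈ cap (w j) (2 * ε), a = ((inner ℝ x y : ℝ) : EReal)}

/-- `γ(β) = 1 - α - 8ε - β⁻¹ log (2n²/ε)`. -/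
def gamma {d k : ℕ} (n : ℕ) (ε : ℝ) (w : Fin k → USphere d) (β : ℝ) : EReal :=
  1 - alpha ε w - ((8 * ε : ℝ) : EReal)
    - ((1 / β * Real.log (2 * (n : ℝ) ^ 2 / ε) : ℝ) : EReal)

/-- The points `w` are `(β, ε)`-centered: `γ(β) > 0`, and `γ = Ω(1)`, i.e. `liminf γ(b) > 0` as
`b → ∞`. -/
def IsCentered {d k : ℕ} (n : ℕ) (β ε : ℝ) (w : Fin k → USphere d) : Prop :=
  0 < gamma n ε w β ∧ 0 < liminf (fun b : ℝ => gamma n ε w b) atTop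

/-- `x = (x₁, …, xₙ)` is a `(β, ε)`-separated configuration: the points are covered by the caps
around at most `n` points of the sphere, which satisfy the condition on `γ`. (A point of a cap
lies on the sphere, so `x` is a tuple of points of the sphere.) -/
def IsSeparated {d n : ℕ} (β ε : ℝ) (x : Fin n → EuclideanSpace ℝ (Fin d)) : Prop :=
  ∃ k : ℕ, k ≤ n ∧ ∃ w : Fin k → USphere d,
    (∀ i : Fin n, x i ∈ ⋃ q : Fin k, cap (w q) ε) ∧ IsCentered n β ε w

/-- The density of the uniform mixture of the `r` isotropic Gaussians on `ℝ^d` with means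
`√r wᵢ` and covariance `σ² I_d`. -/
def mixtureDensity {d r : ℕ} (σ : ℝ) (w : Fin r → USphere d)
    (x : EuclideanSpace ℝ (Fin d)) : ℝ :=
  1 / ((r : ℝ) * Real.sqrt (2 * Real.pi * σ ^ 2) ^ d) *
    ∑ i : Fin r, Real.exp
      (-‖x - Real.sqrt r • (w i : EuclideanSpace ℝ (Fin d))‖ ^ 2 / (2 * σ ^ 2))

/-- The Gaussian mixture law, with density `mixtureDensity` with respect to Lebesgue measure. -/
def gaussianMixture {d r : ℕ} (σ : ℝ) (w : Fin r → USphere d) :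
    Measure (EuclideanSpace ℝ (Fin d)) :=
  volume.withDensity (fun x => ENNReal.ofReal (mixtureDensity σ w x))

end SelfAttention

end

open MeasureTheory ProbabilityTheory

namespace SelfAttention

/-! The witnesses for separation are the given centers `w` themselves, so only covering by caps must
be checked. If `x` lies within `√r ε` of some mean `√r w q`, its direction lies in the cap of `w q`
(`normalize_mem_cap`). A sample misses every such ball with probability at most `2 ^ d * exp (-(3/8)
(ε/δ)²)` by a Chernoff bound on each Gaussian component. The smallness assumption forces `(ε/δ)² ≥ 9
d + 4 log n`, and a union bound over the `n` samples then leaves at most `2 e^{-d}`. -/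

/-- A nearby point of a unit vector makes a small angle with it. -/
lemma normalize_mem_cap {d : ℕ} (w : USphere d) {s ε : ℝ} (hs : 0 < s) (hε : 0 ≤ ε) (hε1 : ε < 1)
    {x : EuclideanSpace ℝ (Fin d)}
    (hx : ‖x - s • (w : EuclideanSpace ℝ (Fin d))‖ ≤ s * ε) :
    ‖x‖⁻¹ • x ∈ cap w ε := by
  have hw : ‖(w : EuclideanSpace ℝ (Fin d))‖ = 1 := by simp
  have hsq : ‖x - s • (w : EuclideanSpace ℝ (Fin d))‖ ^ 2
      = ‖x‖ ^ 2 - 2 * (s * inner ℝ x (w : EuclideanSpace ℝ (Fin d))) + s ^ 2 := by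
    rw [norm_sub_sq_real, inner_smul_right, norm_smul, hw, Real.norm_of_nonneg hs.le, mul_one]
  have hle : ‖x - s • (w : EuclideanSpace ℝ (Fin d))‖ ^ 2 ≤ (s * ε) ^ 2 :=
    pow_le_pow_left₀ (norm_nonneg _) hx 2
  have hx0 : x ≠ 0 := by
    rintro rfl
    rw [zero_sub, norm_neg, norm_smul, hw, Real.norm_of_nonneg hs.le] at hx
    nlinarith
  have hpos : 0 < ‖x‖ := norm_pos_iff.2 hx0
  refine ⟨?_, ?_⟩
  · rw [mem_sphere_zero_iff_norm, norm_smul, norm_inv, norm_norm, inv_mul_cancel₀ hpos.ne']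
  · rw [real_inner_smul_left, ← div_eq_inv_mul, le_div_iff₀ hpos]
    refine le_of_mul_le_mul_left ?_ hs
    -- Twice the gap is at least `(‖x‖ - s(1-ε))² + 2 s² ε (1-ε)`.
    nlinarith [sq_nonneg (‖x‖ - s * (1 - ε)),
      mul_nonneg (sq_nonneg s) (mul_nonneg hε (sub_nonneg.2 hε1.le))]

/-- The integral of an isotropic Gaussian on `ℝ^d`, in terms of lower Lebesgue integrals. -/
lemma lintegral_exp_neg_mul_norm_sub_sq {d : ℕ} {b : ℝ} (hb : 0 < b)
    (m : EuclideanSpace ℝ (Fin d)) :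
    ∫⁻ x, ENNReal.ofReal (Real.exp (-b * ‖x - m‖ ^ 2)) =
      ENNReal.ofReal (Real.sqrt (Real.pi / b) ^ d) := by
  have hval : ∫ x : EuclideanSpace ℝ (Fin d), Real.exp (-b * ‖x‖ ^ 2)
      = Real.sqrt (Real.pi / b) ^ d := by
    rw [GaussianFourier.integral_rexp_neg_mul_sq_norm hb, finrank_euclideanSpace_fin,
      Real.sqrt_eq_rpow, ← Real.rpow_mul_natCast (by positivity)]
    congr 1
    ring
  have hint : Integrable fun x : EuclideanSpace ℝ (Fin d) => Real.exp (-b * ‖x‖ ^ 2) := by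
    -- The Bochner integral of a non-integrable function is `0`, so a positive value proves
    -- integrability.
    refine Integrable.of_integral_ne_zero ?_
    rw [hval]
    positivity
  rw [lintegral_sub_right_eq_self (fun x : EuclideanSpace ℝ (Fin d) =>
      ENNReal.ofReal (Real.exp (-b * ‖x‖ ^ 2))) m,
    ← ofReal_integral_eq_lintegral_ofReal hint (ae_of_all _ fun _ => (Real.exp_pos _).le), hval]

/-- Chernoff bound for the tail of an unnormalized isotropic Gaussian on `ℝ^d`. -/
lemma setLIntegral_gaussian_tail_le {d : ℕ} {σ ρ : ℝ} (hσ : 0 < σ) (hρ : 0 ≤ ρ)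
    (m : EuclideanSpace ℝ (Fin d)) :
    ∫⁻ x in {x | ρ < ‖x - m‖}, ENNReal.ofReal (Real.exp (-‖x - m‖ ^ 2 / (2 * σ ^ 2))) ≤
      ENNReal.ofReal (Real.exp (-(3 * ρ ^ 2 / (8 * σ ^ 2)))
        * (2 ^ d * Real.sqrt (2 * Real.pi * σ ^ 2) ^ d)) := by
  -- Split `1/(2σ²) = 3/(8σ²) + 1/(8σ²)`: the first part is bounded by its value at radius `ρ`, the
  -- second is a Gaussian of standard deviation `2σ`, whence the factor `2 ^ d`.
  have hb : 0 < 1 / (8 * σ ^ 2) := by positivity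
  have hroot : Real.sqrt (Real.pi / (1 / (8 * σ ^ 2))) = 2 * Real.sqrt (2 * Real.pi * σ ^ 2) := by
    rw [show Real.pi / (1 / (8 * σ ^ 2)) = 2 ^ 2 * (2 * Real.pi * σ ^ 2) by field_simp; ring,
      Real.sqrt_mul (by positivity), Real.sqrt_sq (by norm_num)]
  have hmeas : MeasurableSet {x : EuclideanSpace ℝ (Fin d) | ρ < ‖x - m‖} :=
    (isOpen_lt continuous_const (by fun_prop)).measurableSet
  calc _ ≤ ∫⁻ x in {x | ρ < ‖x - m‖}, ENNReal.ofReal (Real.exp (-(3 * ρ ^ 2 / (8 * σ ^ 2))))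
        * ENNReal.ofReal (Real.exp (-(1 / (8 * σ ^ 2)) * ‖x - m‖ ^ 2)) := by
        refine setLIntegral_mono' hmeas fun x hx => ?_
        rw [← ENNReal.ofReal_mul (Real.exp_pos _).le, ← Real.exp_add]
        refine ENNReal.ofReal_le_ofReal (Real.exp_le_exp.2 ?_)
        have hsq : ρ ^ 2 ≤ ‖x - m‖ ^ 2 := pow_le_pow_left₀ hρ (le_of_lt hx) 2
        rw [show -(3 * ρ ^ 2 / (8 * σ ^ 2)) + -(1 / (8 * σ ^ 2)) * ‖x - m‖ ^ 2
          = (-(3 * ρ ^ 2) - ‖x - m‖ ^ 2) / (8 * σ ^ 2) by ring,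
          show -‖x - m‖ ^ 2 / (2 * σ ^ 2) = (-4 * ‖x - m‖ ^ 2) / (8 * σ ^ 2) by
            field_simp; ring]
        gcongr
        linarith
    _ ≤ ∫⁻ x, ENNReal.ofReal (Real.exp (-(3 * ρ ^ 2 / (8 * σ ^ 2))))
        * ENNReal.ofReal (Real.exp (-(1 / (8 * σ ^ 2)) * ‖x - m‖ ^ 2)) :=
        setLIntegral_le_lintegral _ _
    _ = _ := by
        rw [lintegral_const_mul' _ _ ENNReal.ofReal_ne_top, lintegral_exp_neg_mul_norm_sub_sq hb,
          ← ENNReal.ofReal_mul (Real.exp_pos _).le, hroot, mul_pow]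

/-- The Gaussian mixture gives small mass to the points far away from all the means. -/
lemma gaussianMixture_far_le {d r : ℕ} (hr : 1 ≤ r) {σ ρ : ℝ} (hσ : 0 < σ) (hρ : 0 ≤ ρ)
    (w : Fin r → USphere d) :
    gaussianMixture σ w
        {x | ∀ q, ρ < ‖x - Real.sqrt r • (w q : EuclideanSpace ℝ (Fin d))‖} ≤
      ENNReal.ofReal (2 ^ d * Real.exp (-(3 * ρ ^ 2 / (8 * σ ^ 2)))) := by
  set A := {x : EuclideanSpace ℝ (Fin d) |
    ∀ q, ρ < ‖x - Real.sqrt r • (w q : EuclideanSpace ℝ (Fin d))‖} with hA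
  have hAm : MeasurableSet A := by
    rw [hA, Set.ofPred_forall]
    exact MeasurableSet.iInter fun q =>
      (isOpen_lt continuous_const (by fun_prop)).measurableSet
  have hr0 : (0 : ℝ) < r := by exact_mod_cast hr
  have hc : 0 < Real.sqrt (2 * Real.pi * σ ^ 2) := Real.sqrt_pos.2 (by positivity)
  set c := Real.sqrt (2 * Real.pi * σ ^ 2) with hcdef
  rw [gaussianMixture, withDensity_apply _ hAm]
  have hdens : ∀ x, ENNReal.ofReal (mixtureDensity σ w x) =
      ENNReal.ofReal (1 / (r * c ^ d)) * ∑ q : Fin r, ENNReal.ofReal (Real.exp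
        (-‖x - Real.sqrt r • (w q : EuclideanSpace ℝ (Fin d))‖ ^ 2 / (2 * σ ^ 2))) := by
    intro x
    rw [mixtureDensity, ENNReal.ofReal_mul (by positivity),
      ENNReal.ofReal_sum_of_nonneg fun _ _ => (Real.exp_pos _).le]
  simp_rw [hdens]
  rw [lintegral_const_mul' _ _ ENNReal.ofReal_ne_top,
    lintegral_finsetSum _ fun q _ => by fun_prop]
  calc _ ≤ ENNReal.ofReal (1 / (r * c ^ d)) * ∑ q : Fin r,
        ENNReal.ofReal (Real.exp (-(3 * ρ ^ 2 / (8 * σ ^ 2))) * (2 ^ d * c ^ d)) := by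
        gcongr with q
        have hsub : A ⊆ {x | ρ < ‖x - Real.sqrt r • (w q : EuclideanSpace ℝ (Fin d))‖} :=
          fun x hx => hx q
        exact (lintegral_mono_set hsub).trans (setLIntegral_gaussian_tail_le hσ hρ _)
    _ = _ := by
        rw [← ENNReal.ofReal_sum_of_nonneg fun _ _ => by positivity,
          ← ENNReal.ofReal_mul (by positivity), Finset.sum_const, Finset.card_univ,
          Fintype.card_fin, nsmul_eq_mul]
        congr 1
        field_simp

/-- The smallness assumption bounds the rescaled squared radius `(ε / δ)²` from below. -/
lemma radius_sq_ge {d n : ℕ} (hd : 2 ≤ d) (hn : 1 ≤ n) {ε δ : ℝ} (hδ : 0 < δ)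
    (hε : ε < 1 / 16)
    (hsmall : 6 * δ * Real.sqrt d / (1 + δ * Real.sqrt d)
      + δ * Real.sqrt (2 * d * Real.log n) ≤ ε) :
    9 * d + 4 * Real.log n ≤ (ε / δ) ^ 2 := by
  have hlog : 0 ≤ Real.log n := Real.log_nonneg (by exact_mod_cast hn)
  have hd' : (2 : ℝ) ≤ d := by exact_mod_cast hd
  have hs : 0 ≤ δ * Real.sqrt d := by positivity
  have hL : 0 ≤ δ * Real.sqrt (2 * d * Real.log n) := by positivity
  have hfrac : 6 * δ * Real.sqrt d / (1 + δ * Real.sqrt d) ≤ 1 / 16 := by linarith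
  have hs1 : δ * Real.sqrt d ≤ 1 := by
    rw [div_le_iff₀ (by positivity)] at hfrac
    linarith
  -- The denominator is at most `2` since `δ√d ≤ 1`.
  have hlin : 3 * (δ * Real.sqrt d) ≤ 6 * δ * Real.sqrt d / (1 + δ * Real.sqrt d) := by
    rw [le_div_iff₀ (by positivity)]
    nlinarith
  have hmain : 3 * Real.sqrt d + Real.sqrt (2 * d * Real.log n) ≤ ε / δ := by
    rw [le_div_iff₀ hδ]
    linarith
  have hsq := pow_le_pow_left₀ (by positivity) hmain 2
  have h1 : Real.sqrt d ^ 2 = d := Real.sq_sqrt (by positivity)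
  have h2 : Real.sqrt (2 * d * Real.log n) ^ 2 = 2 * d * Real.log n :=
    Real.sq_sqrt (by positivity)
  -- Drop the cross term of the square; `d ≥ 2` turns `2 d log n` into `4 log n`.
  nlinarith [mul_nonneg (Real.sqrt_nonneg d) (Real.sqrt_nonneg (2 * d * Real.log n)),
    mul_nonneg (sub_nonneg.2 hd') hlog]

/-- The union bound over `n` samples costs at most the available failure probability. -/
lemma card_mul_tail_le {d n : ℕ} (hn : 1 ≤ n) {T : ℝ} (hT : 9 * d + 4 * Real.log n ≤ T) :
    n * (2 ^ d * Real.exp (-(3 * T / 8))) ≤ 2 * Real.exp (-(d : ℝ)) := by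
  have hn0 : (0 : ℝ) < n := by exact_mod_cast hn
  have hlog : 0 ≤ Real.log n := Real.log_nonneg (by exact_mod_cast hn)
  have h2 : (2 : ℝ) ^ d ≤ Real.exp d := by
    rw [← mul_one (d : ℝ), Real.exp_nat_mul]
    exact pow_le_pow_left₀ (by norm_num) (by linarith [Real.add_one_le_exp (1 : ℝ)]) d
  calc n * (2 ^ d * Real.exp (-(3 * T / 8)))
      ≤ Real.exp (Real.log n) * (Real.exp d * Real.exp (-(3 * T / 8))) := by
        rw [Real.exp_log hn0]
        gcongr
    _ = Real.exp (Real.log n + (d + -(3 * T / 8))) := by rw [Real.exp_add, Real.exp_add]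
    -- The exponent is at most `-(19/8) d - (1/2) log n`.
    _ ≤ Real.exp (-(d : ℝ)) := Real.exp_le_exp.2 (by
        have : (0 : ℝ) ≤ d := Nat.cast_nonneg d
        linarith)
    _ ≤ _ := by linarith [Real.exp_pos (-(d : ℝ))]

end SelfAttention

open SelfAttention in
theorem proposition4p2 {d n r : ℕ} (hd : 2 ≤ d) (hn : 2 ≤ n) (hr : 1 ≤ r) (hrn : r ≤ n)
    {β ε σ δ : ℝ} (hβ : 0 < β) (hε : 0 < ε) (hε' : ε < 1 / 16) (hσ : 0 < σ)
    (hδ : δ = σ / Real.sqrt r)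
    (w : Fin r → SelfAttention.USphere d) (hw : SelfAttention.IsCentered n β ε w)
    (hsmall : 6 * δ * Real.sqrt d / (1 + δ * Real.sqrt d)
      + δ * Real.sqrt (2 * d * Real.log n) ≤ ε)
    {Ω : Type*} [MeasurableSpace Ω] (P : MeasureTheory.Measure Ω)
    [MeasureTheory.IsProbabilityMeasure P]
    (X : Fin n → Ω → EuclideanSpace ℝ (Fin d))
    (hX_law : ∀ i, ProbabilityTheory.HasLaw (X i) (SelfAttention.gaussianMixture σ w) P)
    (hX_indep : ProbabilityTheory.iIndepFun X P) :
    1 - 2 * Real.exp (-(d : ℝ)) ≤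
      P.real {ω | SelfAttention.IsSeparated β ε (fun i => ‖X i ω‖⁻¹ • X i ω)} := by
  have hr0 : 0 < Real.sqrt r := Real.sqrt_pos.2 (by exact_mod_cast hr)
  have hδ0 : 0 < δ := hδ ▸ div_pos hσ hr0
  set A := {x : EuclideanSpace ℝ (Fin d) |
    ∀ q, Real.sqrt r * ε < ‖x - Real.sqrt r • (w q : EuclideanSpace ℝ (Fin d))‖} with hA
  set S := {ω | IsSeparated β ε (fun i => ‖X i ω‖⁻¹ • X i ω)} with hS
  have hAm : MeasurableSet A := by
    rw [hA, Set.ofPred_forall]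
    exact MeasurableSet.iInter fun q =>
      (isOpen_lt continuous_const (by fun_prop)).measurableSet
  -- Covering the whole space, rather than taking complements, avoids proving `S` measurable.
  have hcover : Set.univ ⊆ S ∪ ⋃ i, X i ⁻¹' A := by
    intro ω _
    by_cases h : ∃ i, X i ω ∈ A
    · exact Or.inr (Set.mem_iUnion.2 h)
    · refine Or.inl ⟨r, hrn, w, fun i => ?_, hw⟩
      have hi : X i ω ∉ A := fun hi => h ⟨i, hi⟩
      simp only [hA, Set.mem_ofPred_eq, not_forall, not_lt] at hi
      obtain ⟨q, hq⟩ := hi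
      exact Set.mem_iUnion.2 ⟨q, normalize_mem_cap (w q) hr0 hε.le (by linarith) hq⟩
  have hone : ∀ i, P.real (X i ⁻¹' A) ≤ 2 ^ d * Real.exp (-(3 * (ε / δ) ^ 2 / 8)) := by
    intro i
    have hlaw : P (X i ⁻¹' A) = gaussianMixture σ w A := by
      rw [← (hX_law i).map_eq, Measure.map_apply_of_aemeasurable (hX_law i).aemeasurable hAm]
    rw [measureReal_def, hlaw]
    refine ENNReal.toReal_le_of_le_ofReal (by positivity) ?_
    -- With `ρ = √r ε` and `δ = σ/√r`, one has `ρ/σ = ε/δ`.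
    convert gaussianMixture_far_le hr hσ (mul_nonneg hr0.le hε.le) w using 5
    rw [hδ]
    field_simp
  have hsum : P.real (⋃ i, X i ⁻¹' A) ≤ 2 * Real.exp (-(d : ℝ)) :=
    calc P.real (⋃ i, X i ⁻¹' A) ≤ ∑ i, P.real (X i ⁻¹' A) := measureReal_iUnion_fintype_le _
      _ ≤ ∑ _i : Fin n, 2 ^ d * Real.exp (-(3 * (ε / δ) ^ 2 / 8)) :=
        Finset.sum_le_sum fun i _ => hone i
      _ = n * (2 ^ d * Real.exp (-(3 * (ε / δ) ^ 2 / 8))) := by simp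
      _ ≤ _ := card_mul_tail_le (by omega) (radius_sq_ge hd (by omega) hδ0 hε' hsmall)
  have htot : 1 ≤ P.real S + P.real (⋃ i, X i ⁻¹' A) :=
    calc 1 = P.real Set.univ := by simp
      _ ≤ P.real (S ∪ ⋃ i, X i ⁻¹' A) := measureReal_mono hcover
      _ ≤ _ := measureReal_union_le _ _
  linarith
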